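/- Let $m\ge 1$, let $\mathbb R^m$ carry the Euclidean norm, let $I$ be a nonempty compact Hausdorff space, and let $f_i:\mathbb R^m\to\mathbb R$ $(i\in I)$ be convex functions such that $i\mapsto f_i(x)$ is continuous on $I$ for every $x\in\mathbb R^m$. Put $f(x):=\max_{i\in I}f_i(x)$ and $I_f(x):=\{i\in I: f_i(x)=f(x)\}$, and let $f'(x,h):=\lim_{t\to0^+}\frac{f(x+th)-f(x)}{t}$ be the directional derivative. Let $\bar x\in\mathbb R^m$ satisfy $f(\bar x)=0$. For a family $G=(g_i)_{i\in I}$ of convex functions $g_i:\mathbb R^m\to\mathbb R$ with $(i,x)\mapsto G(i,x):=g_i(x)$ continuous on $I\times\mathbb R^m$, put $g(x):=\max_{i\in I}g_i(x)$, $I_g(x):=\{i\in I:g_i(x)=g(x)\}$ and $S_G:=\{x: g_i(x)\le 0\ \text{for all } i\in I\}$, and let the local error bound modulus $\tau_{\min}(G,\bar x)\in[0,+\infty]$ be the infimum of all $\tau>0$ for which there is $\delta>0$ with $$d(x,S_G)\le\tau\max\{g(x),0\}\qquad\text{for all }x\in B(\bar x,\delta),$$ where $\inf\emptyset=+\infty$.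 The following statements are equivalent: (i) $\min_{\|h\|=1}f'(\bar x,h)\neq0$. (ii) There exist constants $c,\varepsilon>0$ such that $\tau_{\min}(G,\bar x)\le c$ for every continuous $G:I\times\mathbb R^m\to\mathbb R$ with all $g_i:=G(i,\cdot)$ convex that satisfies: $g(\bar x)=0$; $I_g(\bar x)\subseteq I_f(\bar x)$ whenever $\min_{\|h\|=1}f'(\bar x,h)<0$; $I_f(\bar x)\subseteq I_g(\bar x)$ whenever $\min_{\|h\|=1}f'(\bar x,h)>0$; and $$\limsup_{x\to\bar x}\frac{|(f_i(x)-g_i(x))-(f_i(\bar x)-g_i(\bar x))|}{\|x-\bar x\|}\le\varepsilon\qquad\text{for all } i\in I_f(\bar x)\cap I_g(\bar x).$$ (iii) There exist constants $c,\varepsilon>0$ such that for all $u^*\in\mathbb R^m$ with $\|u^*\|\le1$ one has $\tau_{\min}(G,\bar x)\le c$, where $G(i,x):=f_i(x)+\varepsilon\langle u^*,x-\bar x\rangle$ for all $(i,x)\in I\times\mathbb R^m$. -/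

import Mathlib

open Set Filter Topology

noncomputable section

/-- Shorthand for the Euclidean space `ℝᵐ`. -/
abbrev Euc (m : ℕ) : Type := EuclideanSpace ℝ (Fin m)

/-- The directional derivative `f'(x, h) = lim_{t → 0⁺} (f (x + t h) - f x) / t`. -/
def dirDeriv {m : ℕ} (f : Euc m → ℝ) (x h : Euc m) : ℝ :=
  limUnder (𝓝[>] (0 : ℝ)) (fun t : ℝ => (f (x + t • h) - f x) / t)

/-- `min_{‖h‖ = 1} f'(x, h)`. -/
def minDirDeriv {m : ℕ} (f : Euc m → ℝ) (x : Euc m) : ℝ :=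
  sInf (dirDeriv f x '' {h : Euc m | ‖h‖ = 1})

/-- `f x = max_{i ∈ I} f_i x`. -/
def maxFun {m : ℕ} {I : Type*} (F : I → Euc m → ℝ) (x : Euc m) : ℝ :=
  sSup (range fun i => F i x)

/-- The active index set `I_f(x) = {i : f_i x = f x}`. -/
def activeIdx {m : ℕ} {I : Type*} (F : I → Euc m → ℝ) (x : Euc m) : Set I :=
  {i | F i x = maxFun F x}

/-- The solution set of the system `f_i ≤ 0`, `i ∈ I`. -/
def solSet {m : ℕ} {I : Type*} (F : I → Euc m → ℝ) : Set (Euc m) :=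
  {x | ∀ i, F i x ≤ 0}

/-- The system has a local error bound at `xbar` with constant `τ`:
`d(x, S_F) ≤ τ [f x]₊` on some ball `B(xbar, δ)`; the distance to the empty set is `∞`. -/
def HasLocalErrorBound {m : ℕ} {I : Type*} (F : I → Euc m → ℝ) (xbar : Euc m) (τ : ℝ) : Prop :=
  ∃ δ : ℝ, 0 < δ ∧ ∀ x ∈ Metric.ball xbar δ,
    Metric.infEDist x (solSet F) ≤ ENNReal.ofReal (τ * max (maxFun F x) 0)

/-- The local error bound modulus `τ_min(F, xbar)`: the infimum, in the extended reals, of all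
`τ > 0` that are constants of a local error bound at `xbar`; it is `+∞` if there is none. -/
def localModulus {m : ℕ} {I : Type*} (F : I → Euc m → ℝ) (xbar : Euc m) : EReal :=
  sInf {T : EReal | ∃ τ : ℝ, 0 < τ ∧ HasLocalErrorBound F xbar τ ∧ T = (τ : EReal)}

/-- `limsup_{x → xbar} |(φ x - ψ x) - (φ xbar - ψ xbar)| / ‖x - xbar‖`, in the extended reals. -/
def localDeviation {m : ℕ} (φ ψ : Euc m → ℝ) (xbar : Euc m) : EReal :=
  limsup (fun x : Euc m =>
    ((|(φ x - ψ x) - (φ xbar - ψ xbar)| / ‖x - xbar‖ : ℝ) : EReal)) (𝓝[≠] xbar)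

/-- The maximum defining `maxFun` is attained on a nonempty compact index space. -/
theorem isGreatest_maxFun {m : ℕ} {I : Type*} [TopologicalSpace I] [CompactSpace I] [Nonempty I]
    (F : I → Euc m → ℝ) (x : Euc m) (hF : Continuous fun i => F i x) :
    IsGreatest (range fun i => F i x) (maxFun F x) :=
  (isCompact_range hF).isGreatest_sSup (range_nonempty _)

/-- For a finite convex function the limit defining the directional derivative exists. -/
theorem tendsto_dirDeriv {m : ℕ} {f : Euc m → ℝ} (hf : ConvexOn ℝ univ f) (x h : Euc m) :
    Tendsto (fun t : ℝ => (f (x + t • h) - f x) / t) (𝓝[>] (0 : ℝ)) (𝓝 (dirDeriv f x h)) := by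
  have hc : ConvexOn ℝ univ (fun t : ℝ => f (x + t • h)) := by
    refine ⟨convex_univ, fun s _ t _ a b ha hb hab => ?_⟩
    have := hf.2 (mem_univ (x + s • h)) (mem_univ (x + t • h)) ha hb hab
    convert this using 2
    rw [smul_add, smul_add, add_add_add_comm, ← add_smul, hab, one_smul, add_smul]
    simp [smul_smul]
  have hd := hc.hasDerivWithinAt_rightDeriv_of_mem_interior (x := 0) (by simp)
  rw [hasDerivWithinAt_iff_tendsto_slope' self_notMem_Ioi] at hd
  have hd' : Tendsto (fun t : ℝ => (f (x + t • h) - f x) / t) (𝓝[>] (0 : ℝ))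
      (𝓝 (derivWithin (fun t : ℝ => f (x + t • h)) (Ioi 0) 0)) := by
    refine hd.congr fun t => ?_
    simp [slope_def_field]
  exact tendsto_nhds_limUnder ⟨_, hd'⟩

/-- For a finite convex function on `ℝᵐ`, `m ≥ 1`, the minimum defining `minDirDeriv` is
attained. -/
theorem isLeast_minDirDeriv {m : ℕ} (hm : 1 ≤ m) {f : Euc m → ℝ} (hf : ConvexOn ℝ univ f)
    (x : Euc m) :
    IsLeast (dirDeriv f x '' {h : Euc m | ‖h‖ = 1}) (minDirDeriv f x) := by
  have hconv : ConvexOn ℝ univ (dirDeriv f x) := by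
    refine ⟨convex_univ, fun h _ k _ a b ha hb hab => ?_⟩
    refine le_of_tendsto_of_tendsto (tendsto_dirDeriv hf x _)
      (((tendsto_dirDeriv hf x h).const_smul a).add ((tendsto_dirDeriv hf x k).const_smul b)) ?_
    filter_upwards [self_mem_nhdsWithin] with t ht
    have ht : (0 : ℝ) < t := ht
    have key := hf.2 (mem_univ (x + t • h)) (mem_univ (x + t • k)) ha hb hab
    have e : a • (x + t • h) + b • (x + t • k) = x + t • (a • h + b • k) := by
      rw [smul_add, smul_add, add_add_add_comm, ← add_smul, hab, one_smul, smul_add,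
        smul_comm a t, smul_comm b t]
    rw [e] at key
    simp only [smul_eq_mul] at key ⊢
    rw [← mul_div_assoc, ← mul_div_assoc, ← add_div]
    refine div_le_div_of_nonneg_right ?_ ht.le
    have : f x = a * f x + b * f x := by rw [← add_mul, hab, one_mul]
    linarith
  have hcont : Continuous (dirDeriv f x) := hconv.locallyLipschitz.continuous
  have hcomp : IsCompact {h : Euc m | ‖h‖ = 1} := by
    have e : {h : Euc m | ‖h‖ = 1} = Metric.sphere 0 1 :=
      Set.ext fun h => (mem_sphere_zero_iff_norm).symm
    rw [e]
    exact isCompact_sphere _ _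
  refine (hcomp.image hcont).isLeast_sInf (Nonempty.image _ ?_)
  exact ⟨EuclideanSpace.single ⟨0, hm⟩ 1, by simp⟩

end

section ErrorBoundStability

variable {m : ℕ} {I : Type*}

/-! Write γ for the minimal slope of f = `maxFun F` at the zero `xbar`. The sign of γ decides
everything, because difference quotients of convex functions are monotone along rays. The link
between f and single F_i is compactness: if f grows at rate at least a along a ray, one active F_i
already does (`exists_active_mul_le`). Hence a deviation bound on common active indices suffices.

If γ > 0, in each direction an active F_i grows at rate γ; the perturbed G_i keeps rate γ/2, so g
grows linearly and the error bound constant is 2/γ. If γ < 0, a direction of steepest descent for f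
still yields a Slater point for G, otherwise an active G_i, and with it F_i, would descend too
slowly. Both constants depend on γ only.

If γ = 0, `xbar` minimises f and some unit h has slope zero. A small tilt along h confines the
solution set to a half-space, while g at `xbar + t • h` is only a small multiple of the distance t.
-/

theorem ConvexOn.apply_add_smul_le {f : Euc m → ℝ} (hf : ConvexOn ℝ univ f) (x h : Euc m)
    {s t : ℝ} (hs : 0 ≤ s) (hst : s ≤ t) (ht : 0 < t) :
    f (x + s • h) ≤ s / t * f (x + t • h) + (1 - s / t) * f x := by
  have hst' : s / t ≤ 1 := (div_le_one ht).2 hst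
  have key := hf.2 (mem_univ (x + t • h)) (mem_univ x)
    (div_nonneg hs ht.le) (sub_nonneg.2 hst') (by ring)
  have e : (s / t) • (x + t • h) + (1 - s / t) • x = x + s • h := by
    rw [smul_add, smul_smul, div_mul_cancel₀ _ ht.ne', sub_smul, one_smul]
    abel
  rw [e] at key
  simpa [smul_eq_mul] using key

/-- Difference quotients of a convex function are monotone. -/
theorem ConvexOn.sub_div_le_sub_div {f : Euc m → ℝ} (hf : ConvexOn ℝ univ f) (x h : Euc m)
    {s t : ℝ} (hs : 0 < s) (hst : s ≤ t) :
    (f (x + s • h) - f x) / s ≤ (f (x + t • h) - f x) / t := by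
  have ht := hs.trans_le hst
  have key := hf.apply_add_smul_le x h hs.le hst ht
  rw [div_le_iff₀ hs]
  calc f (x + s • h) - f x ≤ s / t * f (x + t • h) + (1 - s / t) * f x - f x := by linarith
    _ = (f (x + t • h) - f x) / t * s := by ring

theorem dirDeriv_mul_le {f : Euc m → ℝ} (hf : ConvexOn ℝ univ f) (x h : Euc m) {t : ℝ}
    (ht : 0 < t) : dirDeriv f x h * t ≤ f (x + t • h) - f x := by
  rw [← le_div_iff₀ ht]
  refine le_of_tendsto (tendsto_dirDeriv hf x h) ?_
  filter_upwards [Ioc_mem_nhdsGT ht] with s hs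
  exact hf.sub_div_le_sub_div x h hs.1 hs.2

/-- Monotone quotients turn a bound near 0 into one on the whole ray. This lets the infinitesimal
deviation hypothesis give estimates at every distance. -/
theorem ConvexOn.mul_le_of_eventually {f : Euc m → ℝ} (hf : ConvexOn ℝ univ f) (x h : Euc m)
    {a : ℝ} (ha : ∀ᶠ t : ℝ in 𝓝[>] 0, a * t ≤ f (x + t • h) - f x) {t : ℝ} (ht : 0 < t) :
    a * t ≤ f (x + t • h) - f x := by
  obtain ⟨s, hs, hs'⟩ := (ha.and (Ioc_mem_nhdsGT ht)).exists
  rw [← le_div_iff₀ ht]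
  exact ((le_div_iff₀ hs'.1).2 hs).trans (hf.sub_div_le_sub_div x h hs'.1 hs'.2)

theorem localModulus_le {F : I → Euc m → ℝ} {x : Euc m} {τ : ℝ} (hτ : 0 < τ) (h : HasLocalErrorBound F x τ) :
    localModulus F x ≤ (τ : EReal) :=
  sInf_le ⟨τ, hτ, h, rfl⟩

/-! ### Maxima of compact families of convex functions -/

variable [TopologicalSpace I] [CompactSpace I] [Nonempty I] {F G : I → Euc m → ℝ}

theorem le_maxFun (hF : ∀ x, Continuous fun i => F i x) (i : I) (x : Euc m) :
    F i x ≤ maxFun F x :=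
  (isGreatest_maxFun F x (hF x)).2 ⟨i, rfl⟩

theorem exists_eq_maxFun (hF : ∀ x, Continuous fun i => F i x) (x : Euc m) :
    ∃ i, F i x = maxFun F x :=
  (isGreatest_maxFun F x (hF x)).1

theorem maxFun_le (hF : ∀ x, Continuous fun i => F i x) {x : Euc m} {a : ℝ}
    (h : ∀ i, F i x ≤ a) : maxFun F x ≤ a := by
  obtain ⟨i, hi⟩ := exists_eq_maxFun hF x
  exact hi ▸ h i

theorem maxFun_add (hF : ∀ x, Continuous fun i => F i x) (φ : Euc m → ℝ) (x : Euc m) :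
    maxFun (fun i y => F i y + φ y) x = maxFun F x + φ x := by
  have hG : ∀ y, Continuous fun i => F i y + φ y := fun y => (hF y).add continuous_const
  refine le_antisymm (maxFun_le hG fun i => ?_) ?_
  · simpa using le_maxFun hF i x
  · obtain ⟨i, hi⟩ := exists_eq_maxFun hF x
    rw [← hi]
    exact le_maxFun (F := fun i y => F i y + φ y) hG i x

theorem convexOn_maxFun (hF : ∀ x, Continuous fun i => F i x)
    (hc : ∀ i, ConvexOn ℝ univ (F i)) : ConvexOn ℝ univ (maxFun F) := by
  refine ⟨convex_univ, fun x _ y _ a b ha hb hab => maxFun_le hF fun i => ?_⟩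
  refine ((hc i).2 (mem_univ x) (mem_univ y) ha hb hab).trans ?_
  simp only [smul_eq_mul]
  exact add_le_add (mul_le_mul_of_nonneg_left (le_maxFun hF i x) ha)
    (mul_le_mul_of_nonneg_left (le_maxFun hF i y) hb)

theorem ConvexOn.continuous_euc {f : Euc m → ℝ} (hf : ConvexOn ℝ univ f) : Continuous f :=
  hf.locallyLipschitz.continuous

/-- If `maxFun F` grows at rate at least `a` along a ray, so does one single active function. -/
theorem exists_active_mul_le (hF : ∀ x, Continuous fun i => F i x)
    (hc : ∀ i, ConvexOn ℝ univ (F i)) {x : Euc m} (hx : maxFun F x = 0) (h : Euc m) {a : ℝ}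
    (ha : ∀ t : ℝ, 0 < t → a * t ≤ maxFun F (x + t • h)) :
    ∃ i ∈ activeIdx F x, ∀ t : ℝ, 0 < t → a * t ≤ F i (x + t • h) := by
  have hnon : ∀ i, F i x ≤ 0 := fun i => hx ▸ le_maxFun hF i x
  -- Since F i x ≤ 0, the bound propagates outward. The sets `K t` below are therefore nested, and
  -- compactness gives one index valid for all t; letting t → 0 shows that it is active.
  have hmono : ∀ {s t : ℝ}, 0 < s → s ≤ t → ∀ i, a * s ≤ F i (x + s • h) →
      a * t ≤ F i (x + t • h) := by
    intro s t hs hst i hi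
    have ht := hs.trans_le hst
    have h1 := (hc i).apply_add_smul_le x h hs.le hst ht
    have h2 : (1 - s / t) * F i x ≤ 0 :=
      mul_nonpos_of_nonneg_of_nonpos (sub_nonneg.2 ((div_le_one ht).2 hst)) (hnon i)
    have h3 : s / t * (a * t) ≤ s / t * F i (x + t • h) := by
      have : s / t * (a * t) = a * s := by field_simp
      linarith
    exact le_of_mul_le_mul_left h3 (by positivity)
  let K : Ioi (0 : ℝ) → Set I := fun t => {i | a * t ≤ F i (x + (t : ℝ) • h)}
  have hcl : ∀ t, IsClosed (K t) := fun t => isClosed_le continuous_const (hF _)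
  obtain ⟨i, hi⟩ : (⋂ t, K t).Nonempty := by
    have : Nonempty (Ioi (0 : ℝ)) := ⟨⟨1, mem_Ioi.2 one_pos⟩⟩
    refine IsCompact.nonempty_iInter_of_directed_nonempty_isCompact_isClosed K ?_ ?_
      (fun t => (hcl t).isCompact) hcl
    · intro s t
      exact ⟨min s t, fun i hi => hmono (min s t).2 (min_le_left s t) i hi,
        fun i hi => hmono (min s t).2 (min_le_right s t) i hi⟩
    · intro t
      obtain ⟨i, hi⟩ := exists_eq_maxFun hF (x + (t : ℝ) • h)
      exact ⟨i, by simpa [K, hi] using ha t t.2⟩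
  have hi' : ∀ t : ℝ, 0 < t → a * t ≤ F i (x + t • h) := fun t ht =>
    mem_iInter.1 hi ⟨t, ht⟩
  refine ⟨i, ?_, hi'⟩
  have hcont : Continuous fun t : ℝ => F i (x + t • h) :=
    (hc i).continuous_euc.comp (by fun_prop)
  have l1 : Tendsto (fun t : ℝ => F i (x + t • h)) (𝓝[>] 0) (𝓝 (F i x)) := by
    have := (hcont.tendsto 0).mono_left (nhdsWithin_le_nhds (s := Ioi 0))
    simpa using this
  have l2 : Tendsto (fun t : ℝ => a * t) (𝓝[>] 0) (𝓝 0) := by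
    have hlin : Continuous fun t : ℝ => a * t := by fun_prop
    have := (hlin.tendsto 0).mono_left (nhdsWithin_le_nhds (s := Ioi 0))
    simpa using this
  have h0 : 0 ≤ F i x := le_of_tendsto_of_tendsto l2 l1 (by
    filter_upwards [self_mem_nhdsWithin] with t ht
    exact hi' t ht)
  show F i x = maxFun F x
  rw [hx]
  exact le_antisymm (hnon i) h0

/-- A pointwise continuous family of convex functions is jointly continuous. -/
theorem continuous_uncurry_of_convexOn (hF : ∀ x, Continuous fun i => F i x)
    (hc : ∀ i, ConvexOn ℝ univ (F i)) : Continuous fun p : I × Euc m => F p.1 p.2 := by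
  rw [continuous_iff_continuousAt]
  rintro ⟨i₀, x₀⟩
  obtain ⟨M, hM⟩ : ∃ M, ∀ y ∈ Metric.ball x₀ 2, maxFun F y ≤ M := by
    obtain ⟨M, hM⟩ := (isCompact_closedBall x₀ 2).bddAbove_image
      (convexOn_maxFun hF hc).continuous_euc.continuousOn
    exact ⟨M, fun y hy => hM ⟨y, Metric.ball_subset_closedBall hy, rfl⟩⟩
  obtain ⟨b, hb⟩ : ∃ b, ∀ i, b ≤ F i x₀ := by
    obtain ⟨b, hb⟩ := (isCompact_range (hF x₀)).bddBelow
    exact ⟨b, fun i => hb ⟨i, rfl⟩⟩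
  have hup : ∀ i, ∀ y ∈ Metric.ball x₀ 2, F i y ≤ M := fun i y hy =>
    (le_maxFun hF i y).trans (hM y hy)
  -- Reflecting y in x₀ turns the uniform upper bound into a lower one; the two give a Lipschitz
  -- constant independent of i.
  have hlow : ∀ i, ∀ y ∈ Metric.ball x₀ 2, 2 * b - M ≤ F i y := by
    intro i y hy
    have hy' : x₀ + x₀ - y ∈ Metric.ball x₀ 2 := by
      rw [mem_ball_iff_norm] at hy ⊢
      rwa [show x₀ + x₀ - y - x₀ = -(y - x₀) by abel, norm_neg]
    have h1 := (hc i).2 (mem_univ y) (mem_univ (x₀ + x₀ - y))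
      (by norm_num : (0 : ℝ) ≤ 1 / 2) (by norm_num : (0 : ℝ) ≤ 1 / 2) (by norm_num)
    have e : (1 / 2 : ℝ) • y + (1 / 2 : ℝ) • (x₀ + x₀ - y) = x₀ := by
      module
    rw [e] at h1
    simp only [smul_eq_mul] at h1
    linarith [hup i _ hy', hb i]
  let C := max |M| |2 * b - M|
  have habs : ∀ i a, dist a x₀ < 2 → |F i a| ≤ C := by
    intro i a ha
    have h1 := hup i a ha
    have h2 := hlow i a ha
    rw [abs_le]
    constructor
    · linarith [neg_abs_le (2 * b - M), le_max_right |M| |2 * b - M|]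
    · linarith [le_abs_self M, le_max_left |M| |2 * b - M|]
  have hlip : ∀ i, LipschitzOnWith (2 * C / 1).toNNReal (F i) (Metric.ball x₀ (2 - 1)) :=
    fun i => ((hc i).subset (subset_univ _) (convex_ball _ _)).lipschitzOnWith_of_abs_le
      one_pos (habs i)
  set L : ℝ := ((2 * C / 1).toNNReal : ℝ)
  have hlim : Tendsto (fun p : I × Euc m => L * dist p.2 x₀ + dist (F p.1 x₀) (F i₀ x₀))
      (𝓝 (i₀, x₀)) (𝓝 0) := by
    have hcont : Continuous fun p : I × Euc m => L * dist p.2 x₀ + dist (F p.1 x₀) (F i₀ x₀) :=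
      (continuous_const.mul (continuous_snd.dist continuous_const)).add
        (((hF x₀).comp continuous_fst).dist continuous_const)
    simpa using hcont.tendsto (i₀, x₀)
  refine tendsto_iff_dist_tendsto_zero.2 (squeeze_zero' (.of_forall fun _ => dist_nonneg) ?_ hlim)
  have hnb : ∀ᶠ p : I × Euc m in 𝓝 (i₀, x₀), p.2 ∈ Metric.ball x₀ (2 - 1) :=
    continuous_snd.continuousAt (Metric.ball_mem_nhds _ (by norm_num))
  filter_upwards [hnb] with p hp
  refine (dist_triangle _ (F p.1 x₀) _).trans (add_le_add ?_ le_rfl)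
  exact (hlip p.1).dist_le_mul p.2 hp x₀ (Metric.mem_ball_self (by norm_num))

/-- Along a ray, a bound on the local deviation bounds the deviation of the two functions. -/
theorem eventually_abs_le_of_localDeviation_le {φ ψ : Euc m → ℝ} {x h : Euc m} (hh : ‖h‖ = 1)
    {ε η : ℝ} (hφψ : localDeviation φ ψ x ≤ (ε : EReal)) (hη : ε < η) :
    ∀ᶠ t : ℝ in 𝓝[>] 0, |(φ (x + t • h) - ψ (x + t • h)) - (φ x - ψ x)| ≤ η * t := by
  have h1 : localDeviation φ ψ x < (η : EReal) := hφψ.trans_lt (EReal.coe_lt_coe_iff.2 hη)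
  have h2 := eventually_lt_of_limsup_lt h1
  have hray : Tendsto (fun t : ℝ => x + t • h) (𝓝[>] 0) (𝓝[≠] x) := by
    refine tendsto_nhdsWithin_iff.2 ⟨?_, ?_⟩
    · have : Continuous fun t : ℝ => x + t • h := by fun_prop
      have := (this.tendsto 0).mono_left (nhdsWithin_le_nhds (s := Ioi 0))
      simpa using this
    · filter_upwards [self_mem_nhdsWithin] with t ht
      have h0 : h ≠ 0 := by
        rintro rfl
        simp at hh
      simpa using ⟨(mem_Ioi.1 ht).ne', h0⟩
  filter_upwards [hray.eventually h2, self_mem_nhdsWithin] with t ht ht0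
  have ht0 : (0 : ℝ) < t := ht0
  have e : ‖x + t • h - x‖ = t := by
    rw [add_sub_cancel_left, norm_smul, hh, mul_one, Real.norm_of_nonneg ht0.le]
  rw [e, EReal.coe_lt_coe_iff, div_lt_iff₀ ht0] at ht
  exact ht.le

/-! ### Two sources of error bounds -/

/-- Linear growth of the maximum function at a zero gives an error bound. -/
theorem hasLocalErrorBound_of_growth (hF : ∀ x, Continuous fun i => F i x) {x : Euc m}
    (hx : maxFun F x = 0) {a : ℝ} (ha : 0 < a) (hgrow : ∀ y, a * ‖y - x‖ ≤ maxFun F y) :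
    HasLocalErrorBound F x a⁻¹ := by
  refine ⟨1, one_pos, fun y _ => ?_⟩
  have hmem : x ∈ solSet F := fun i => hx ▸ le_maxFun hF i x
  refine (Metric.infEDist_le_edist_of_mem hmem).trans ?_
  rw [edist_dist, dist_eq_norm]
  refine ENNReal.ofReal_le_ofReal ?_
  rw [inv_mul_eq_div, le_div_iff₀ ha, mul_comm]
  exact (hgrow y).trans (le_max_left _ _)

/-- A Slater point gives an error bound. -/
theorem hasLocalErrorBound_of_slater (hF : ∀ x, Continuous fun i => F i x)
    (hc : ∀ i, ConvexOn ℝ univ (F i)) {x h : Euc m} (hh : ‖h‖ = 1) {a t : ℝ} (ha : 0 < a)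
    (ht : 0 < t) (hslater : maxFun F (x + t • h) < -(a * t)) :
    HasLocalErrorBound F x a⁻¹ := by
  have hcx := convexOn_maxFun hF hc
  have hcont : Continuous fun y => maxFun F (y + t • h) :=
    hcx.continuous_euc.comp (by fun_prop)
  obtain ⟨δ, hδ, hball⟩ := Metric.mem_nhds_iff.1
    ((hcont.tendsto x).eventually_lt_const hslater)
  refine ⟨δ, hδ, fun y hy => ?_⟩
  have hy' : maxFun F (y + t • h) < -(a * t) := hball hy
  set p := max (maxFun F y) 0 with hp
  have hp0 : 0 ≤ p := le_max_right _ _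
  have hat : 0 < a * t := by positivity
  have hden : 0 < p + a * t := by positivity
  -- The point where the chord from height p at y to height -(a t) at `y + t • h` crosses zero; it
  -- satisfies s ≤ p / a.
  let s := p / (p + a * t) * t
  have hs0 : 0 ≤ s := by positivity
  have hst : s ≤ t := mul_le_of_le_one_left ht.le ((div_le_one hden).2 (by linarith))
  have hdiv : s / t = p / (p + a * t) := mul_div_cancel_right₀ _ ht.ne'
  have hmem : y + s • h ∈ solSet F := by
    intro i
    refine (le_maxFun hF i _).trans ((hcx.apply_add_smul_le y h hs0 hst ht).trans ?_)
    rw [hdiv]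
    have h1 : p / (p + a * t) * maxFun F (y + t • h) ≤ p / (p + a * t) * -(a * t) :=
      mul_le_mul_of_nonneg_left hy'.le (by positivity)
    have h2 : 1 - p / (p + a * t) = a * t / (p + a * t) := by
      field_simp
      ring
    have h3 : a * t / (p + a * t) * maxFun F y ≤ a * t / (p + a * t) * p :=
      mul_le_mul_of_nonneg_left (le_max_left _ _) (by positivity)
    have h4 : p / (p + a * t) * -(a * t) + a * t / (p + a * t) * p = 0 := by ring
    rw [h2]
    linarith
  refine (Metric.infEDist_le_edist_of_mem hmem).trans ?_
  rw [edist_dist, dist_eq_norm]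
  refine ENNReal.ofReal_le_ofReal ?_
  have e : ‖y - (y + s • h)‖ = s := by
    rw [sub_add_cancel_left, norm_neg, norm_smul, hh, mul_one, Real.norm_of_nonneg hs0]
  rw [e, inv_mul_eq_div, le_div_iff₀ ha]
  calc s * a = p * (a * t / (p + a * t)) := by ring
    _ ≤ p := mul_le_of_le_one_right hp0 ((div_le_one hden).2 (by linarith))

theorem minDirDeriv_le_dirDeriv {f : Euc m → ℝ} (hm : 1 ≤ m) (hf : ConvexOn ℝ univ f)
    (x : Euc m) {h : Euc m} (hh : ‖h‖ = 1) : minDirDeriv f x ≤ dirDeriv f x h :=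
  (isLeast_minDirDeriv hm hf x).2 ⟨h, hh, rfl⟩

/-- The slope at x lies below every difference quotient. In particular x is a global minimiser when
the minimal slope is zero. -/
theorem minDirDeriv_mul_norm_le {f : Euc m → ℝ} (hm : 1 ≤ m) (hf : ConvexOn ℝ univ f)
    (x y : Euc m) : minDirDeriv f x * ‖y - x‖ ≤ f y - f x := by
  rcases eq_or_ne y x with rfl | hne
  · simp
  have hn : 0 < ‖y - x‖ := norm_pos_iff.2 (sub_ne_zero.2 hne)
  have hh : ‖(‖y - x‖⁻¹) • (y - x)‖ = 1 := by
    rw [norm_smul, norm_inv, norm_norm, inv_mul_cancel₀ hn.ne']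
  have key := dirDeriv_mul_le hf x (‖y - x‖⁻¹ • (y - x)) hn
  rw [smul_smul, mul_inv_cancel₀ hn.ne', one_smul, add_sub_cancel] at key
  exact (mul_le_mul_of_nonneg_right (minDirDeriv_le_dirDeriv hm hf x hh) hn.le).trans key

/-! ### Stability and instability by the sign of the minimal slope -/

/-- Stability of the error bound when the minimal directional derivative is positive. -/
theorem localModulus_le_of_pos (hm : 1 ≤ m) (hF : ∀ x, Continuous fun i => F i x)
    (hFc : ∀ i, ConvexOn ℝ univ (F i)) (hG : ∀ x, Continuous fun i => G i x)
    (hGc : ∀ i, ConvexOn ℝ univ (G i)) {x : Euc m} (hFx : maxFun F x = 0)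
    (hGx : maxFun G x = 0) (hpos : 0 < minDirDeriv (maxFun F) x)
    (hact : activeIdx F x ⊆ activeIdx G x) {ε : ℝ} (hε : ε < minDirDeriv (maxFun F) x / 2)
    (hdev : ∀ i ∈ activeIdx F x ∩ activeIdx G x, localDeviation (F i) (G i) x ≤ (ε : EReal)) :
    localModulus G x ≤ (((minDirDeriv (maxFun F) x / 2)⁻¹ : ℝ) : EReal) := by
  set γ := minDirDeriv (maxFun F) x with hγ
  have hcx := convexOn_maxFun hF hFc
  refine localModulus_le (by positivity)
    (hasLocalErrorBound_of_growth hG hGx (by positivity) fun y => ?_)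
  rcases eq_or_ne y x with rfl | hne
  · simp [hGx]
  have hn : 0 < ‖y - x‖ := norm_pos_iff.2 (sub_ne_zero.2 hne)
  set h := ‖y - x‖⁻¹ • (y - x) with hhdef
  have hh : ‖h‖ = 1 := by
    rw [hhdef, norm_smul, norm_inv, norm_norm, inv_mul_cancel₀ hn.ne']
  obtain ⟨i, hi, hgi⟩ := exists_active_mul_le hF hFc hFx h (a := γ) fun t ht => by
    have := dirDeriv_mul_le hcx x h ht
    rw [hFx, sub_zero] at this
    exact (mul_le_mul_of_nonneg_right (minDirDeriv_le_dirDeriv hm hcx x hh) ht.le).trans this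
  have hFi : F i x = 0 := hFx ▸ hi
  have hGi : G i x = 0 := hGx ▸ hact hi
  have hev : ∀ᶠ t : ℝ in 𝓝[>] 0, γ / 2 * t ≤ G i (x + t • h) - G i x := by
    filter_upwards [eventually_abs_le_of_localDeviation_le hh (hdev i ⟨hi, hact hi⟩) hε,
      self_mem_nhdsWithin] with t ht ht0
    have h1 := hgi t ht0
    rw [hFi, hGi] at ht
    rw [hGi]
    linarith [(abs_le.1 ht).2]
  have key := (hGc i).mul_le_of_eventually x h hev hn
  rw [hGi, sub_zero, hhdef, smul_smul, mul_inv_cancel₀ hn.ne', one_smul, add_sub_cancel] at key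
  exact key.trans (le_maxFun hG i y)

/-- Stability of the error bound when the minimal directional derivative is negative. -/
theorem localModulus_le_of_neg (hm : 1 ≤ m) (hF : ∀ x, Continuous fun i => F i x)
    (hFc : ∀ i, ConvexOn ℝ univ (F i)) (hG : ∀ x, Continuous fun i => G i x)
    (hGc : ∀ i, ConvexOn ℝ univ (G i)) {x : Euc m} (hFx : maxFun F x = 0)
    (hGx : maxFun G x = 0) (hneg : minDirDeriv (maxFun F) x < 0)
    (hact : activeIdx G x ⊆ activeIdx F x) {ε : ℝ} (hε : ε < -minDirDeriv (maxFun F) x / 2)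
    (hdev : ∀ i ∈ activeIdx F x ∩ activeIdx G x, localDeviation (F i) (G i) x ≤ (ε : EReal)) :
    localModulus G x ≤ (((-minDirDeriv (maxFun F) x / 4)⁻¹ : ℝ) : EReal) := by
  have hcx := convexOn_maxFun hF hFc
  obtain ⟨h, hh, hd⟩ := (isLeast_minDirDeriv hm hcx x).1
  have hh : ‖h‖ = 1 := hh
  set γ := minDirDeriv (maxFun F) x with hγ
  have ha : 0 < -γ / 4 := by linarith
  -- Without such t, some active G_i stays above γ/4 · t. The deviation costs at most -γ/2 · t, so f
  -- stays above 3γ/4 · t near 0, contradicting slope γ < 3γ/4 along h.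
  obtain ⟨t, ht, hslater⟩ : ∃ t : ℝ, 0 < t ∧ maxFun G (x + t • h) < -(-γ / 4 * t) := by
    by_contra! hcon
    obtain ⟨i, hi, hgi⟩ := exists_active_mul_le hG hGc hGx h (a := γ / 4) fun t ht => by
      have := hcon t ht
      linarith
    have hGi : G i x = 0 := hGx ▸ hi
    have hFi : F i x = 0 := hFx ▸ hact hi
    have hev : ∀ᶠ t : ℝ in 𝓝[>] 0,
        3 / 4 * γ ≤ (maxFun F (x + t • h) - maxFun F x) / t := by
      filter_upwards [eventually_abs_le_of_localDeviation_le hh (hdev i ⟨hact hi, hi⟩) hε,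
        self_mem_nhdsWithin] with t ht ht0
      have h1 := hgi t ht0
      rw [hFi, hGi] at ht
      rw [le_div_iff₀ ht0, hFx]
      linarith [(abs_le.1 ht).1, le_maxFun hF i (x + t • h)]
    have := ge_of_tendsto (tendsto_dirDeriv hcx x h) hev
    rw [hd] at this
    linarith
  exact localModulus_le (by positivity) (hasLocalErrorBound_of_slater hG hGc hh ha ht hslater)

/-- A small linear perturbation destroys the error bound when the minimal directional derivative
vanishes. -/
theorem exists_not_localModulus_le (hm : 1 ≤ m) (hF : ∀ x, Continuous fun i => F i x)
    (hFc : ∀ i, ConvexOn ℝ univ (F i)) {x : Euc m} (hFx : maxFun F x = 0)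
    (hzero : minDirDeriv (maxFun F) x = 0) {c ε : ℝ} (hc : 0 < c) (hε : 0 < ε) :
    ∃ u : Euc m, ‖u‖ ≤ 1 ∧
      ¬ localModulus (fun i y => F i y + ε * inner ℝ u (y - x)) x ≤ (c : EReal) := by
  have hcx := convexOn_maxFun hF hFc
  obtain ⟨h, hh, hd⟩ := (isLeast_minDirDeriv hm hcx x).1
  have hh : ‖h‖ = 1 := hh
  rw [hzero] at hd
  have hnonneg : ∀ y, 0 ≤ maxFun F y := fun y => by
    have := minDirDeriv_mul_norm_le hm hcx x y
    rw [hzero, hFx] at this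
    linarith
  -- The 1 keeps the tilt in the unit ball; the other term makes its slope ε η at most 1/(4c).
  set η := min 1 (1 / (4 * c * ε)) with hη
  have hη0 : 0 < η := lt_min one_pos (by positivity)
  have hηε : ε * η ≤ 1 / (4 * c) := by
    calc ε * η ≤ ε * (1 / (4 * c * ε)) := mul_le_mul_of_nonneg_left (min_le_right _ _) hε.le
      _ = 1 / (4 * c) := by field_simp
  refine ⟨η • h, ?_, fun hle => ?_⟩
  · rw [norm_smul, hh, mul_one, Real.norm_of_nonneg hη0.le]
    exact min_le_left _ _
  -- The infimum need not be attained, so slack up to 2c is left to extract an actual constant τ.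
  have hlt : localModulus (fun i y => F i y + ε * inner ℝ (η • h) (y - x)) x
      < ((2 * c : ℝ) : EReal) := hle.trans_lt (EReal.coe_lt_coe_iff.2 (by linarith))
  obtain ⟨T, ⟨τ, hτ, ⟨δ, hδ, hbound⟩, rfl⟩, hT⟩ := sInf_lt_iff.1 hlt
  have hτc : τ < 2 * c := EReal.coe_lt_coe_iff.1 hT
  have hsmall : ∀ᶠ t : ℝ in 𝓝[>] 0,
      (maxFun F (x + t • h) - maxFun F x) / t < 1 / (4 * c) :=
    (tendsto_dirDeriv hcx x h).eventually_lt_const (by rw [hd]; positivity)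
  obtain ⟨t, hft, ht0, htδ⟩ := (hsmall.and (Ioo_mem_nhdsGT hδ)).exists
  rw [div_lt_iff₀ ht0, hFx, sub_zero] at hft
  have hinner : inner ℝ h h = (1 : ℝ) := by rw [real_inner_self_eq_norm_sq, hh]; norm_num
  have hball : x + t • h ∈ Metric.ball x δ := by
    rw [mem_ball_iff_norm, add_sub_cancel_left, norm_smul, hh, mul_one,
      Real.norm_of_nonneg ht0.le]
    exact htδ
  have hb := hbound _ hball
  rw [maxFun_add hF (fun y => ε * inner ℝ (η • h) (y - x)), add_sub_cancel_left,
    real_inner_smul_left, real_inner_smul_right, hinner, mul_one] at hb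
  -- As f ≥ 0, a solution y of the tilted system must have ⟨h, y - x⟩ ≤ 0, and `x + t • h` is at
  -- distance t from that half-space.
  have hlower : ENNReal.ofReal t ≤ Metric.infEDist (x + t • h)
      (solSet fun i y => F i y + ε * inner ℝ (η • h) (y - x)) := by
    refine Metric.le_infEDist.2 fun y hy => ?_
    rw [edist_dist, dist_eq_norm]
    refine ENNReal.ofReal_le_ofReal ?_
    obtain ⟨i, hi⟩ := exists_eq_maxFun hF y
    have h1 : F i y + ε * inner ℝ (η • h) (y - x) ≤ 0 := hy i
    rw [hi, real_inner_smul_left] at h1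
    have h2 : inner ℝ h (y - x) ≤ (0 : ℝ) := by
      by_contra! hcon
      have : 0 < ε * (η * inner ℝ h (y - x)) := by positivity
      linarith [hnonneg y]
    have h3 : inner ℝ h (x + t • h - y) = t - inner ℝ h (y - x) := by
      rw [show x + t • h - y = t • h - (y - x) by abel, inner_sub_right,
        real_inner_smul_right, hinner, mul_one]
    have h4 := real_inner_le_norm h (x + t • h - y)
    rw [h3, hh, one_mul] at h4
    linarith
  have hfinal : t ≤ τ * max (maxFun F (x + t • h) + ε * (η * t)) 0 :=
    (ENNReal.ofReal_le_ofReal_iff (by positivity)).1 (hlower.trans hb)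
  rw [max_eq_left (add_nonneg (hnonneg _) (by positivity))] at hfinal
  -- Slope of f plus tilt: 1/(4c) + 1/(4c). With τ < 2c the error bound would then give t < t.
  have h5 : maxFun F (x + t • h) + ε * (η * t) < 1 / (2 * c) * t := by
    have h6 : ε * (η * t) ≤ 1 / (4 * c) * t := by
      rw [← mul_assoc]
      exact mul_le_mul_of_nonneg_right hηε ht0.le
    have h7 : 1 / (2 * c) * t = 1 / (4 * c) * t + 1 / (4 * c) * t := by
      field_simp
      ring
    linarith
  have h8 : τ * (maxFun F (x + t • h) + ε * (η * t)) < τ * (1 / (2 * c) * t) :=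
    mul_lt_mul_of_pos_left h5 hτ
  have h9 : τ * (1 / (2 * c) * t) ≤ 2 * c * (1 / (2 * c) * t) :=
    mul_le_mul_of_nonneg_right hτc.le (by positivity)
  have h10 : 2 * c * (1 / (2 * c) * t) = t := by field_simp
  linarith

theorem localDeviation_add_inner_le (φ : Euc m → ℝ) (x : Euc m) {u : Euc m} (hu : ‖u‖ ≤ 1)
    {ε : ℝ} (hε : 0 ≤ ε) :
    localDeviation φ (fun y => φ y + ε * inner ℝ u (y - x)) x ≤ (ε : EReal) := by
  refine limsup_le_of_le (h := .of_forall fun y => EReal.coe_le_coe_iff.2 ?_)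
  refine div_le_of_le_mul₀ (norm_nonneg _) hε ?_
  have e : φ y - (φ y + ε * inner ℝ u (y - x)) - (φ x - (φ x + ε * inner ℝ u (x - x)))
      = -(ε * inner ℝ u (y - x)) := by
    rw [sub_self, inner_zero_right]
    ring
  rw [e, abs_neg, abs_mul, abs_of_nonneg hε]
  refine mul_le_mul_of_nonneg_left ((abs_real_inner_le_norm _ _).trans ?_) hε
  exact mul_le_of_le_one_left (norm_nonneg _) hu

theorem convexOn_mul_inner_sub (ε : ℝ) (u x : Euc m) :
    ConvexOn ℝ univ fun y : Euc m => ε * inner ℝ u (y - x) := by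
  refine ⟨convex_univ, fun y _ z _ a b _ _ hab => le_of_eq ?_⟩
  have hx : inner ℝ u x = a * inner ℝ u x + b * inner ℝ u x := by rw [← add_mul, hab, one_mul]
  simp only [inner_sub_right, inner_add_right, real_inner_smul_right, smul_eq_mul]
  rw [hx]
  have hb : b = 1 - a := by linarith
  subst hb
  ring

theorem activeIdx_add_of_eq_zero (hF : ∀ x, Continuous fun i => F i x) {φ : Euc m → ℝ}
    {x : Euc m} (hφ : φ x = 0) : activeIdx (fun i y => F i y + φ y) x = activeIdx F x := by
  ext i
  simp only [activeIdx, mem_ofPred_eq]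
  rw [maxFun_add hF, hφ, add_zero, add_zero]

end ErrorBoundStability

theorem theorem4p1 {m : ℕ} (hm : 1 ≤ m)
    {I : Type*} [TopologicalSpace I] [CompactSpace I] [T2Space I] [Nonempty I]
    (F : I → Euc m → ℝ)
    (hF_convex : ∀ i, ConvexOn ℝ univ (F i))
    (hF_cont : ∀ x, Continuous fun i => F i x)
    (xbar : Euc m) (hxbar : maxFun F xbar = 0) :
    List.TFAE [
      minDirDeriv (maxFun F) xbar ≠ 0,
      ∃ c ε : ℝ, 0 < c ∧ 0 < ε ∧ ∀ G : I → Euc m → ℝ,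
        Continuous (fun p : I × Euc m => G p.1 p.2) →
        (∀ i, ConvexOn ℝ univ (G i)) →
        maxFun G xbar = 0 →
        (minDirDeriv (maxFun F) xbar < 0 → activeIdx G xbar ⊆ activeIdx F xbar) →
        (0 < minDirDeriv (maxFun F) xbar → activeIdx F xbar ⊆ activeIdx G xbar) →
        (∀ i ∈ activeIdx F xbar ∩ activeIdx G xbar,
          localDeviation (F i) (G i) xbar ≤ (ε : EReal)) →
        localModulus G xbar ≤ (c : EReal),
      ∃ c ε : ℝ, 0 < c ∧ 0 < ε ∧ ∀ u : Euc m, ‖u‖ ≤ 1 →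
        localModulus (fun i x => F i x + ε * inner ℝ u (x - xbar)) xbar ≤ (c : EReal)] := by
  tfae_have 1 → 2 := by
    intro hne
    rcases lt_or_gt_of_ne hne with hneg | hpos
    · refine ⟨(-minDirDeriv (maxFun F) xbar / 4)⁻¹, -minDirDeriv (maxFun F) xbar / 4,
        inv_pos.2 (by linarith), by linarith, ?_⟩
      intro G hG hGc hGx hact _ hdev
      exact localModulus_le_of_neg hm hF_cont hF_convex
        (fun x => hG.comp (Continuous.prodMk_left x)) hGc hxbar hGx hneg (hact hneg)
        (by linarith) hdev
    · refine ⟨(minDirDeriv (maxFun F) xbar / 2)⁻¹, minDirDeriv (maxFun F) xbar / 4,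
        by positivity, by positivity, ?_⟩
      intro G hG hGc hGx _ hact hdev
      exact localModulus_le_of_pos hm hF_cont hF_convex
        (fun x => hG.comp (Continuous.prodMk_left x)) hGc hxbar hGx hpos (hact hpos)
        (by linarith) hdev
  tfae_have 2 → 3 := by
    rintro ⟨c, ε, hc, hε, H⟩
    refine ⟨c, ε, hc, hε, fun u hu => ?_⟩
    have h0 : (fun y : Euc m => ε * inner ℝ u (y - xbar)) xbar = 0 := by simp
    have hact := activeIdx_add_of_eq_zero
      (φ := fun y => ε * inner ℝ u (y - xbar)) hF_cont h0
    refine H _ ?_ (fun i => (hF_convex i).add (convexOn_mul_inner_sub ε u xbar)) ?_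
      (fun _ => hact.le) (fun _ => hact.ge)
      (fun i _ => localDeviation_add_inner_le (F i) xbar hu hε.le)
    -- F is only assumed continuous in i for fixed x; convexity supplies the joint continuity
    -- demanded of G.
    · exact (continuous_uncurry_of_convexOn hF_cont hF_convex).add (by fun_prop)
    · rw [maxFun_add hF_cont (fun y => ε * inner ℝ u (y - xbar)), hxbar, zero_add]
      exact h0
  tfae_have 3 → 1 := by
    rintro ⟨c, ε, hc, hε, H⟩ hzero
    obtain ⟨u, hu, hnot⟩ :=
      exists_not_localModulus_le hm hF_cont hF_convex hxbar hzero hc hε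
    exact hnot (H u hu)
  tfae_finish
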